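/- For $g\in L^2(\mathbb{R})$ and $\Lambda\subset\mathbb{R}^2$ let $G(g,\Lambda)=\{e^{2\pi i\mu t}g(t-\lambda)\}_{(\lambda,\mu)\in\Lambda}$. A set $\Lambda\subset\mathbb{R}^2$ is uniformly discrete if there is $\delta>0$ such that $|x-y|>\delta$ for all distinct $x,y\in\Lambda$. A system of vectors $\{f_i\}$ in a Hilbert space $H$ is a frame if there are constants $A,B>0$ with $A\|f\|^2\le\sum_i|\langle f,f_i\rangle|^2\le B\|f\|^2$ for all $f\in H$; it is a Riesz sequence if it is a Riesz basis of its closed linear span $W$, i.e. if there are an orthonormal basis $\{e_i\}$ of $W$ and a bounded operator $T:W\to W$ with bounded inverse such that $f_i=Te_i$ for all $i$. Theorem A'. Let $g_1,\dots,g_N$ be distinct functions in $L^2(\mathbb{R})$ and let $\Lambda_1,\dots,\Lambda_N\subset\mathbb{R}^2$ each be uniformly discrete. With $Q_{(a,b)}(R)=\{(x,y):|x-a|\le R,\ |y-b|\le R\}$, the limits $$D^+(\{\Lambda_n\})=\lim_{R\to\infty}\frac{\max_{(a,b)\in\mathbb{R}^2}\sum_{n=1}^N|\Lambda_n\cap Q_{(a,b)}(R)|}{(2R)^2},\qquad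 D^-(\{\Lambda_n\})=\lim_{R\to\infty}\frac{\min_{(a,b)\in\mathbb{R}^2}\sum_{n=1}^N|\Lambda_n\cap Q_{(a,b)}(R)|}{(2R)^2}$$ exist. Consider $\bigcup_{n=1}^N G(g_n,\Lambda_n)$ as the system indexed by all pairs $(n,(\lambda,\mu))$ with $1\le n\le N$ and $(\lambda,\mu)\in\Lambda_n$. 1. If $\bigcup_{n=1}^N G(g_n,\Lambda_n)$ is a Riesz sequence, then $D^+(\{\Lambda_n\})\le 1$. 2. If $\bigcup_{n=1}^N G(g_n,\Lambda_n)$ is a frame, then $D^-(\{\Lambda_n\})\ge 1$. -/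

import Mathlib

open MeasureTheory Filter Topology

noncomputable section

/-! ### Systems of vectors in a Hilbert space -/

section Systems

variable {ι H : Type*} [NormedAddCommGroup H] [InnerProductSpace ℂ H]

/-- A Riesz basis: the image of an orthonormal basis under a bounded operator `T : H → H` with
bounded inverse. -/
def IsRieszBasis (v : ι → H) : Prop :=
  ∃ (e : HilbertBasis ι ℂ H) (T : H ≃L[ℂ] H), ∀ i, v i = T (e i)

/-- The closed linear span of a system of vectors. -/
def closedSpan (v : ι → H) : Submodule ℂ H :=
  (Submodule.span ℂ (Set.range v)).topologicalClosure

theorem mem_closedSpan (v : ι → H) (i : ι) : v i ∈ closedSpan v :=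
  Submodule.le_topologicalClosure _ (Submodule.subset_span (Set.mem_range_self i))

/-- A Riesz sequence: a system that is a Riesz basis of its closed linear span. -/
def IsRieszSequence (v : ι → H) : Prop :=
  IsRieszBasis (H := closedSpan v) (fun i => ⟨v i, mem_closedSpan v i⟩)

/-- A frame: `A‖f‖² ≤ ∑ |⟨f, v i⟩|² ≤ B‖f‖²` for all `f`, with positive constants `A`, `B`. -/
def IsFrame (v : ι → H) : Prop :=
  ∃ A B : ℝ, 0 < A ∧ 0 < B ∧ ∀ f : H,
    Summable (fun i => ‖inner ℂ (v i) f‖ ^ 2) ∧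
    A * ‖f‖ ^ 2 ≤ ∑' i, ‖inner ℂ (v i) f‖ ^ 2 ∧
    ∑' i, ‖inner ℂ (v i) f‖ ^ 2 ≤ B * ‖f‖ ^ 2

end Systems

/-! ### Gabor systems -/

/-- The Hilbert space `L²(ℝ)` of complex-valued functions. -/
abbrev L2R : Type := Lp ℂ 2 (volume : Measure ℝ)

/-- The function `t ↦ e^{2πiμt} g(t - λ)`, where `p = (λ, μ)`. -/
def gaborFun (g : ℝ → ℂ) (p : ℝ × ℝ) (t : ℝ) : ℂ :=
  Complex.exp (2 * Real.pi * Complex.I * p.2 * t) * g (t - p.1)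

theorem memLp_gaborFun (g : L2R) (p : ℝ × ℝ) :
    MemLp (gaborFun g p) 2 (volume : Measure ℝ) := by
  have h1 : MemLp (fun t : ℝ => g (t - p.1)) 2 (volume : Measure ℝ) :=
    (Lp.memLp g).comp_measurePreserving (measurePreserving_sub_right volume p.1)
  refine h1.of_le ?_ (Eventually.of_forall fun t => ?_)
  · refine AEStronglyMeasurable.mul (Continuous.aestronglyMeasurable ?_) h1.1
    fun_prop
  · have h2 : (2 * Real.pi * Complex.I * p.2 * t : ℂ)
        = ((2 * Real.pi * p.2 * t : ℝ) : ℂ) * Complex.I := by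
      push_cast; ring
    rw [gaborFun, norm_mul, h2, Complex.norm_exp_ofReal_mul_I, one_mul]

/-- The time-frequency shift of `g ∈ L²(ℝ)` by `p = (λ, μ)`, as an element of `L²(ℝ)`. -/
def gaborShift (g : L2R) (p : ℝ × ℝ) : L2R :=
  (memLp_gaborFun g p).toLp (gaborFun g p)

/-- The union of the Gabor systems `G(g_n, Λ_n)`, as a system indexed by the pairs consisting of
an index `n` and a point of `Λ_n` (so vectors are counted with multiplicity). -/
def gaborUnion {N : ℕ} (g : Fin N → L2R) (Λ : Fin N → Set (ℝ × ℝ)) :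
    (Σ n : Fin N, Λ n) → L2R :=
  fun i => gaborShift (g i.1) i.2

/-! ### Densities -/

/-- A set of points of the plane is uniformly discrete if the Euclidean distances between its
distinct points exceed some positive constant. -/
def UniformlyDiscrete (Λ : Set (ℝ × ℝ)) : Prop :=
  ∃ δ : ℝ, 0 < δ ∧ ∀ p ∈ Λ, ∀ q ∈ Λ, p ≠ q →
    δ < √((p.1 - q.1) ^ 2 + (p.2 - q.2) ^ 2)

/-- The closed square with center `p` and side length `2R`. -/
def square (p : ℝ × ℝ) (R : ℝ) : Set (ℝ × ℝ) :=
  {q | |q.1 - p.1| ≤ R ∧ |q.2 - p.2| ≤ R}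

/-- `∑ n, |Λ_n ∩ Q_p(R)|` (each term is finite when `Λ_n` is uniformly discrete). -/
def familyCount {N : ℕ} (Λ : Fin N → Set (ℝ × ℝ)) (p : ℝ × ℝ) (R : ℝ) : ℕ :=
  ∑ n, (Λ n ∩ square p R).ncard

/-- `D` is the upper density of the family: the limit of
`max_p ∑ n, |Λ_n ∩ Q_p(R)| / (2R)²` as `R → ∞`. For a uniformly discrete family the counts at
a given `R` are bounded, so that the supremum of natural numbers is a maximum. -/
def HasUpperDensity {N : ℕ} (Λ : Fin N → Set (ℝ × ℝ)) (D : ℝ) : Prop :=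
  Tendsto (fun R : ℝ => ((⨆ p : ℝ × ℝ, familyCount Λ p R : ℕ) : ℝ) / (2 * R) ^ 2)
    atTop (𝓝 D)

/-- `D` is the lower density of the family: the limit of
`min_p ∑ n, |Λ_n ∩ Q_p(R)| / (2R)²` as `R → ∞`. -/
def HasLowerDensity {N : ℕ} (Λ : Fin N → Set (ℝ × ℝ)) (D : ℝ) : Prop :=
  Tendsto (fun R : ℝ => ((⨅ p : ℝ × ℝ, familyCount Λ p R : ℕ) : ℝ) / (2 * R) ^ 2)
    atTop (𝓝 D)

end

/-! The system is compared with a Gabor orthonormal basis of density one: the shifts of the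
indicator of `(0, 1]` over `ℤ²` (`unitBasis`). Two facts carry the comparison.

The homogeneous approximation property (`exists_tail_le`): the coefficients of a shifted function
`gaborShift f p` against a Gabor system that satisfies a Bessel bound over a separated set
concentrate near `p`, with a radius independent of `p`. By covariance the coefficient at `x` has the
modulus of a fixed function at `x - p`. That function is square integrable over the plane, and
strong continuity of the shifts together with the Bessel bound turns integrals into sums over
separated points.

A dimension count (`mul_card_sub_card_le`): if combinations of finitely many vectors are bounded
below by their coefficients, and each vector is nearly carried by a finite set `I` of coordinates,
then `I` cannot be much smaller than the number of vectors.

For a Riesz sequence the vectors are the atoms in a square and the coordinates are those in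
`unitBasis`. For a frame the roles are exchanged. In both cases the coordinate square exceeds the
vector square by a fixed margin `R`, which is negligible after division by the area. Existence of
the densities is a Fekete argument, using coverings and packings of squares by squares. -/

open MeasureTheory Filter Topology

noncomputable section

/-! ### Counting points in squares; existence of the densities -/

section Counting

theorem mem_square {p q : ℝ × ℝ} {R : ℝ} :
    q ∈ square p R ↔ |q.1 - p.1| ≤ R ∧ |q.2 - p.2| ≤ R := Iff.rfl

/-- Points of a set separated by `δ` are determined by the cell of side `δ / 2` they lie in. -/
theorem injOn_floor_of_separated {Λ : Set (ℝ × ℝ)} {δ : ℝ} (hδ : 0 < δ)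
    (h : ∀ p ∈ Λ, ∀ q ∈ Λ, p ≠ q → δ < √((p.1 - q.1) ^ 2 + (p.2 - q.2) ^ 2)) (c : ℝ × ℝ) :
    Set.InjOn (fun x : ℝ × ℝ => (⌊(x.1 - c.1) / (δ / 2)⌋₊, ⌊(x.2 - c.2) / (δ / 2)⌋₊))
      (Λ ∩ {x | c.1 ≤ x.1 ∧ c.2 ≤ x.2}) := by
  have key : ∀ a b : ℝ, 0 ≤ a → 0 ≤ b → ⌊a / (δ / 2)⌋₊ = ⌊b / (δ / 2)⌋₊ →
      (a - b) ^ 2 ≤ (δ / 2) ^ 2 := by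
    intro a b ha hb hab
    have h2 : 0 < δ / 2 := by positivity
    have h3 := Nat.floor_le (div_nonneg ha h2.le)
    have h4 := Nat.lt_floor_add_one (a / (δ / 2))
    have h5 := Nat.floor_le (div_nonneg hb h2.le)
    have h6 := Nat.lt_floor_add_one (b / (δ / 2))
    rw [← hab] at h5 h6
    rw [le_div_iff₀ h2] at h3 h5
    rw [div_lt_iff₀ h2] at h4 h6
    refine sq_le_sq' ?_ ?_ <;> linarith
  rintro x ⟨hx, hx1, hx2⟩ y ⟨hy, hy1, hy2⟩ hxy
  by_contra hne
  have h0 := h x hx y hy hne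
  simp only [Prod.mk.injEq] at hxy
  have h1 := key _ _ (sub_nonneg.2 hx1) (sub_nonneg.2 hy1) hxy.1
  have h2 := key _ _ (sub_nonneg.2 hx2) (sub_nonneg.2 hy2) hxy.2
  -- In one cell the squared distance is at most `2 * (δ / 2) ^ 2`, which is less than `δ ^ 2`.
  rw [Real.lt_sqrt hδ.le] at h0
  nlinarith [sq_pos_of_pos hδ]

theorem UniformlyDiscrete.exists_ncard_le {Λ : Set (ℝ × ℝ)} (h : UniformlyDiscrete Λ) (R : ℝ) :
    ∃ K : ℕ, ∀ p, (Λ ∩ square p R).Finite ∧ (Λ ∩ square p R).ncard ≤ K := by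
  obtain ⟨δ, hδ, h⟩ := h
  set M := ⌊2 * R / (δ / 2)⌋₊
  refine ⟨(Finset.Iic M ×ˢ Finset.Iic M).card, fun p => ?_⟩
  set c : ℝ × ℝ := (p.1 - R, p.2 - R)
  set F := fun x : ℝ × ℝ => (⌊(x.1 - c.1) / (δ / 2)⌋₊, ⌊(x.2 - c.2) / (δ / 2)⌋₊)
  have hinj : Set.InjOn F (Λ ∩ square p R) := by
    refine (injOn_floor_of_separated hδ h c).mono ?_
    rintro x ⟨hx, hx1, hx2⟩
    rw [abs_le] at hx1 hx2
    exact ⟨hx, by dsimp [c]; linarith, by dsimp [c]; linarith⟩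
  have hmaps : Set.MapsTo F (Λ ∩ square p R)
      (Finset.Iic M ×ˢ Finset.Iic M : Finset (ℕ × ℕ)) := by
    rintro x ⟨hx, hx1, hx2⟩
    rw [abs_le] at hx1 hx2
    simp only [Finset.coe_product, Set.mem_prod, Finset.mem_coe, Finset.mem_Iic, F, M, c]
    constructor <;> gcongr <;> linarith
  refine ⟨Set.Finite.of_injOn hmaps hinj (Finset.finite_toSet _), ?_⟩
  rw [← Set.ncard_coe_finset]
  exact Set.ncard_le_ncard_of_injOn F hmaps hinj (Finset.finite_toSet _)

theorem UniformlyDiscrete.finite_inter_square {Λ : Set (ℝ × ℝ)} (h : UniformlyDiscrete Λ)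
    (p : ℝ × ℝ) (R : ℝ) : (Λ ∩ square p R).Finite :=
  ((h.exists_ncard_le R).choose_spec p).1

theorem UniformlyDiscrete.countable {Λ : Set (ℝ × ℝ)} (h : UniformlyDiscrete Λ) :
    Λ.Countable := by
  have : Λ ⊆ ⋃ n : ℕ, Λ ∩ square 0 n := by
    intro x hx
    obtain ⟨n, hn⟩ := exists_nat_ge (max |x.1| |x.2|)
    refine Set.mem_iUnion.2 ⟨n, hx, ?_⟩
    simpa [mem_square] using hn
  exact (Set.countable_iUnion fun n : ℕ => (h.finite_inter_square 0 n).countable).mono this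

variable {N : ℕ} {Λ : Fin N → Set (ℝ × ℝ)}

theorem bddAbove_familyCount (hΛ : ∀ n, UniformlyDiscrete (Λ n)) (R : ℝ) :
    BddAbove (Set.range fun p => familyCount Λ p R) := by
  choose K hK using fun n => (hΛ n).exists_ncard_le R
  refine ⟨∑ n, K n, ?_⟩
  rintro _ ⟨p, rfl⟩
  exact Finset.sum_le_sum fun n _ => (hK n p).2

/-- A family of squares covering a square bounds the count in the latter. -/
theorem familyCount_le_sum (hΛ : ∀ n, UniformlyDiscrete (Λ n)) {ι : Type*} (s : Finset ι)
    (c : ι → ℝ × ℝ) {p : ℝ × ℝ} {R S : ℝ} (h : square p R ⊆ ⋃ i ∈ s, square (c i) S) :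
    familyCount Λ p R ≤ ∑ i ∈ s, familyCount Λ (c i) S := by
  unfold familyCount
  rw [Finset.sum_comm]
  refine Finset.sum_le_sum fun n _ => ?_
  have hfin : (⋃ i ∈ s, Λ n ∩ square (c i) S).Finite :=
    s.finite_toSet.biUnion fun i _ => (hΛ n).finite_inter_square _ _
  refine (Set.ncard_le_ncard ?_ hfin).trans (Finset.set_ncard_biUnion_le _ _)
  rintro x ⟨hx, hx'⟩
  simpa [hx] using h hx'

/-- Disjoint squares inside a square bound the count in the latter from below. -/
theorem sum_le_familyCount (hΛ : ∀ n, UniformlyDiscrete (Λ n)) {ι : Type*} (s : Finset ι)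
    (c : ι → ℝ × ℝ) {p : ℝ × ℝ} {R S : ℝ} (hsub : ∀ i ∈ s, square (c i) S ⊆ square p R)
    (hdis : (s : Set ι).PairwiseDisjoint fun i => square (c i) S) :
    ∑ i ∈ s, familyCount Λ (c i) S ≤ familyCount Λ p R := by
  classical
  unfold familyCount
  rw [Finset.sum_comm]
  refine Finset.sum_le_sum fun n _ => ?_
  have hfin : ∀ i, (Λ n ∩ square (c i) S).Finite := fun i => (hΛ n).finite_inter_square _ _
  have h1 : ∀ i, (Λ n ∩ square (c i) S).ncard = (hfin i).toFinset.card := fun i =>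
    Set.ncard_eq_toFinset_card _ _
  simp_rw [h1]
  rw [Set.ncard_eq_toFinset_card _ ((hΛ n).finite_inter_square p R), ← Finset.card_biUnion]
  · refine Finset.card_le_card fun x hx => ?_
    simp only [Finset.mem_biUnion, Set.Finite.mem_toFinset] at hx ⊢
    obtain ⟨i, hi, hx⟩ := hx
    exact ⟨hx.1, hsub i hi hx.2⟩
  · intro i hi j hj hij
    rw [Function.onFun, Finset.disjoint_left]
    intro x hx hx'
    simp only [Set.Finite.mem_toFinset] at hx hx'
    exact Set.disjoint_left.1 (hdis hi hj hij) hx.2 hx'.2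

/-- `k ^ 2` squares of half-side `S` cover a square of half-side `R`. The strict `R < k * S` keeps
the cell index below `k` even at the right edge. -/
theorem iSup_familyCount_le (hΛ : ∀ n, UniformlyDiscrete (Λ n)) {R S : ℝ} (hS : 0 < S) {k : ℕ}
    (hk : R < k * S) :
    (⨆ p, familyCount Λ p R) ≤ k ^ 2 * ⨆ p, familyCount Λ p S := by
  refine ciSup_le' fun p => ?_
  set c : ℕ × ℕ → ℝ × ℝ := fun i =>
    (p.1 - R + (2 * i.1 + 1) * S, p.2 - R + (2 * i.2 + 1) * S)
  have key : ∀ a b : ℝ, |a - b| ≤ R → ∃ i < k, |a - (b - R + (2 * i + 1) * S)| ≤ S := by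
    intro a b h
    rw [abs_le] at h
    have h0 : 0 ≤ (a - b + R) / (2 * S) := div_nonneg (by linarith) (by linarith)
    refine ⟨⌊(a - b + R) / (2 * S)⌋₊, ?_, ?_⟩
    · rw [Nat.floor_lt h0, div_lt_iff₀ (by linarith)]
      linarith
    · have h1 := Nat.floor_le h0
      have h2 := Nat.lt_floor_add_one ((a - b + R) / (2 * S))
      rw [le_div_iff₀ (by linarith)] at h1
      rw [div_lt_iff₀ (by linarith)] at h2
      rw [abs_le]
      constructor <;> linarith
  refine (familyCount_le_sum hΛ (Finset.range k ×ˢ Finset.range k) c (S := S) ?_).trans ?_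
  · rintro x ⟨hx1, hx2⟩
    obtain ⟨i, hi, hi'⟩ := key _ _ hx1
    obtain ⟨j, hj, hj'⟩ := key _ _ hx2
    simp only [Set.mem_iUnion]
    exact ⟨(i, j), by simp [hi, hj], hi', hj'⟩
  · refine (Finset.sum_le_card_nsmul _ _ _ fun i _ => le_ciSup (bddAbove_familyCount hΛ S) _).trans ?_
    simp [sq]

/-- Packing counterpart of the covering bound. The centers are spaced by `2 * (S + 1)` rather than
`2 * S`, because adjacent closed squares would share boundary points. -/
theorem le_iInf_familyCount (hΛ : ∀ n, UniformlyDiscrete (Λ n)) {R S : ℝ} (hS : 0 < S) {k : ℕ}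
    (hk : k * (S + 1) ≤ R) :
    (k ^ 2 * ⨅ p, familyCount Λ p S) ≤ ⨅ p, familyCount Λ p R := by
  refine le_ciInf fun p => ?_
  set c : ℕ × ℕ → ℝ × ℝ := fun i =>
    (p.1 - R + (2 * i.1 + 1) * (S + 1), p.2 - R + (2 * i.2 + 1) * (S + 1))
  have key : ∀ a b : ℝ, ∀ i < k, |a - (b - R + (2 * i + 1) * (S + 1))| ≤ S → |a - b| ≤ R := by
    intro a b i hi h
    rw [abs_le] at h ⊢
    have h1 : (i : ℝ) + 1 ≤ k := by exact_mod_cast hi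
    have h2 : 0 ≤ (i : ℝ) := by positivity
    constructor <;> nlinarith
  have key2 : ∀ a b : ℝ, ∀ i j : ℕ, |a - (b - R + (2 * i + 1) * (S + 1))| ≤ S →
      |a - (b - R + (2 * j + 1) * (S + 1))| ≤ S → i ≤ j := by
    intro a b i j h h'
    by_contra hij
    have h1 : (j : ℝ) + 1 ≤ i := by exact_mod_cast not_le.1 hij
    rw [abs_le] at h h'
    nlinarith
  refine le_trans ?_ (sum_le_familyCount hΛ (Finset.range k ×ˢ Finset.range k) c (S := S) ?_ ?_)
  · refine le_trans ?_ (Finset.card_nsmul_le_sum _ _ (⨅ p, familyCount Λ p S) fun i _ =>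
      ciInf_le (OrderBot.bddBelow _) _)
    simp [sq]
  · rintro ⟨i, j⟩ hij x ⟨hx1, hx2⟩
    simp only [Finset.mem_product, Finset.mem_range] at hij
    exact ⟨key _ _ i hij.1 hx1, key _ _ j hij.2 hx2⟩
  · rintro ⟨i, j⟩ - ⟨i', j'⟩ - hne
    rw [Function.onFun, Set.disjoint_left]
    rintro x ⟨h1, h2⟩ ⟨h1', h2'⟩
    exact hne (Prod.ext (le_antisymm (key2 _ _ _ _ h1 h1') (key2 _ _ _ _ h1' h1))
      (le_antisymm (key2 _ _ _ _ h2 h2') (key2 _ _ _ _ h2' h2)))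

/-- A version of Fekete's lemma for subadditive counting functions on squares. -/
theorem tendsto_div_sq_of_le {M : ℝ → ℕ}
    (h : ∀ R S : ℝ, ∀ k : ℕ, 0 < S → R < k * S → M R ≤ k ^ 2 * M S) :
    ∃ D : ℝ, Tendsto (fun R : ℝ => (M R : ℝ) / (2 * R) ^ 2) atTop (𝓝 D) := by
  set u : ℝ → ℝ := fun R => (M R : ℝ) / (2 * R) ^ 2
  have hb : BddBelow (u '' Set.Ioi 0) := ⟨0, by rintro _ ⟨R, -, rfl⟩; positivity⟩
  have hne : (u '' Set.Ioi 0).Nonempty := ⟨u 1, 1, by simp, rfl⟩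
  -- As in Fekete's lemma, the limit is the infimum; the covering bound from a near-optimal `S`
  -- controls all large `R`.
  refine ⟨sInf (u '' Set.Ioi 0), tendsto_order.2 ⟨fun a ha => ?_, fun a ha => ?_⟩⟩
  · filter_upwards [eventually_gt_atTop 0] with R hR
    exact ha.trans_le (csInf_le hb ⟨R, hR, rfl⟩)
  · obtain ⟨_, ⟨S, hS, rfl⟩, hSa⟩ := exists_lt_of_csInf_lt hne ha
    have hS : 0 < S := hS
    have hlim : Tendsto (fun R : ℝ => (1 + S * R⁻¹) ^ 2 * u S) atTop (𝓝 (u S)) := by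
      have := ((tendsto_inv_atTop_zero.const_mul S).const_add (1 : ℝ)).pow 2 |>.mul_const (u S)
      simpa using this
    filter_upwards [eventually_gt_atTop 0, hlim.eventually_lt_const hSa] with R hR hlt
    refine lt_of_le_of_lt ?_ hlt
    have h1 := h R S (⌊R / S⌋₊ + 1) hS (by
      have := Nat.lt_floor_add_one (R / S)
      rw [div_lt_iff₀ hS] at this
      exact_mod_cast this)
    have h2 : (M R : ℝ) ≤ (⌊R / S⌋₊ + 1 : ℝ) ^ 2 * M S := by exact_mod_cast h1
    have h3 : (⌊R / S⌋₊ : ℝ) ≤ R / S := Nat.floor_le (by positivity)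
    have h4 : (M R : ℝ) ≤ (R / S + 1 : ℝ) ^ 2 * M S := h2.trans (by gcongr)
    dsimp only [u]
    calc (M R : ℝ) / (2 * R) ^ 2 ≤ ((R / S + 1 : ℝ) ^ 2 * M S) / (2 * R) ^ 2 := by gcongr
      _ = _ := by field_simp

/-- The superadditive case. The gap in `k * (S + 1)` calls for the normalization `(2 * (R + 1)) ^
2`; the limit is the supremum of these ratios, finite by `hC`, and replacing `R + 1` by `R` does not
change it. -/
theorem tendsto_div_sq_of_ge {m : ℝ → ℕ} {C : ℝ}
    (hC : ∀ R : ℝ, 0 < R → (m R : ℝ) ≤ C * (R + 1) ^ 2)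
    (h : ∀ R S : ℝ, ∀ k : ℕ, 0 < S → k * (S + 1) ≤ R → k ^ 2 * m S ≤ m R) :
    ∃ D : ℝ, Tendsto (fun R : ℝ => (m R : ℝ) / (2 * R) ^ 2) atTop (𝓝 D) := by
  set u : ℝ → ℝ := fun R => (m R : ℝ) / (2 * (R + 1)) ^ 2
  have hb : BddAbove (u '' Set.Ioi 0) := by
    refine ⟨C / 4, ?_⟩
    rintro _ ⟨R, hR, rfl⟩
    have hR : 0 < R := hR
    have := hC R hR
    dsimp only [u]
    rw [div_le_iff₀ (by positivity)]
    linarith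
  have hne : (u '' Set.Ioi 0).Nonempty := ⟨u 1, 1, by simp, rfl⟩
  set L := sSup (u '' Set.Ioi 0)
  refine ⟨L, tendsto_order.2 ⟨fun a ha => ?_, fun a ha => ?_⟩⟩
  · obtain ⟨_, ⟨S, hS, rfl⟩, hSa⟩ := exists_lt_of_lt_csSup hne ha
    have hS : 0 < S := hS
    have hlim : Tendsto (fun R : ℝ => (1 - (S + 1) * R⁻¹) ^ 2 * u S) atTop (𝓝 (u S)) := by
      have := ((tendsto_inv_atTop_zero.const_mul (S + 1)).const_sub (1 : ℝ)).pow 2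
        |>.mul_const (u S)
      simpa using this
    filter_upwards [eventually_gt_atTop (S + 1), hlim.eventually_const_lt hSa] with R hR hlt
    refine lt_of_lt_of_le hlt ?_
    have hS1 : 0 < S + 1 := by linarith
    have hR0 : 0 < R := by linarith
    have h1 := h R S ⌊R / (S + 1)⌋₊ hS (by
      have := Nat.floor_le (div_nonneg hR0.le hS1.le)
      rwa [le_div_iff₀ hS1] at this)
    have h2 : (⌊R / (S + 1)⌋₊ : ℝ) ^ 2 * m S ≤ m R := by exact_mod_cast h1
    have h3 := Nat.lt_floor_add_one (R / (S + 1))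
    have h5 : 0 ≤ R / (S + 1) - 1 := by
      rw [sub_nonneg, le_div_iff₀ hS1]; linarith
    have h4 : (R / (S + 1) - 1) ^ 2 * m S ≤ m R := by
      refine le_trans ?_ h2
      gcongr
      linarith
    dsimp only [u]
    calc _ = ((R / (S + 1) - 1) ^ 2 * m S) / (2 * R) ^ 2 := by field_simp
      _ ≤ _ := by gcongr
  · have hlim : Tendsto (fun R : ℝ => (1 + R⁻¹) ^ 2 * L) atTop (𝓝 L) := by
      have := (tendsto_inv_atTop_zero.const_add (1 : ℝ)).pow 2 |>.mul_const L
      simpa using this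
    filter_upwards [eventually_gt_atTop 0, hlim.eventually_lt_const ha] with R hR hlt
    refine lt_of_le_of_lt ?_ hlt
    have h1 : u R ≤ L := le_csSup hb ⟨R, hR, rfl⟩
    calc (m R : ℝ) / (2 * R) ^ 2 = (1 + R⁻¹) ^ 2 * u R := by dsimp only [u]; field_simp
      _ ≤ _ := by gcongr

theorem exists_hasUpperDensity (hΛ : ∀ n, UniformlyDiscrete (Λ n)) :
    ∃ D, HasUpperDensity Λ D :=
  tendsto_div_sq_of_le fun _ _ _ hS hk => iSup_familyCount_le hΛ hS hk

theorem exists_hasLowerDensity (hΛ : ∀ n, UniformlyDiscrete (Λ n)) :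
    ∃ D, HasLowerDensity Λ D := by
  refine tendsto_div_sq_of_ge (C := (⨆ p, familyCount Λ p 1 : ℕ)) (fun R hR => ?_)
    fun _ _ _ hS hk => le_iInf_familyCount hΛ hS hk
  have h1 : (⨅ p, familyCount Λ p R) ≤ ⨆ p, familyCount Λ p R :=
    (ciInf_le (OrderBot.bddBelow _) 0).trans (le_ciSup (bddAbove_familyCount hΛ R) 0)
  have h2 := iSup_familyCount_le hΛ one_pos (R := R) (k := ⌊R⌋₊ + 1)
    (by simpa using Nat.lt_floor_add_one R)
  have h3 : ((⨅ p, familyCount Λ p R : ℕ) : ℝ) ≤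
      (⌊R⌋₊ + 1 : ℝ) ^ 2 * (⨆ p, familyCount Λ p 1 : ℕ) := by exact_mod_cast h1.trans h2
  refine h3.trans ?_
  rw [mul_comm]
  gcongr
  exact Nat.floor_le hR.le

end Counting

/-! ### Time-frequency shifts: covariance and strong continuity -/

section Shifts

theorem coeFn_gaborShift (g : L2R) (p : ℝ × ℝ) : gaborShift g p =ᵐ[volume] gaborFun g p :=
  MemLp.coeFn_toLp _

theorem gaborShift_zero (g : L2R) : gaborShift g 0 = g := by
  refine Lp.ext ((coeFn_gaborShift g 0).trans (Eventually.of_forall fun t => ?_))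
  simp [gaborFun]

theorem inner_gaborShift (g f : L2R) (p q : ℝ × ℝ) :
    inner ℂ (gaborShift g p) (gaborShift f q)
      = ∫ t, gaborFun f q t * (starRingEnd ℂ) (gaborFun g p t) := by
  rw [L2.inner_def]
  refine integral_congr_ae ?_
  filter_upwards [coeFn_gaborShift g p, coeFn_gaborShift f q] with t h1 h2
  rw [h1, h2, RCLike.inner_apply]

theorem inner_gaborShift_left (g f : L2R) (p : ℝ × ℝ) :
    inner ℂ (gaborShift g p) f = ∫ t, f t * (starRingEnd ℂ) (gaborFun g p t) := by
  rw [L2.inner_def]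
  refine integral_congr_ae ?_
  filter_upwards [coeFn_gaborShift g p] with t h1
  rw [h1, RCLike.inner_apply]

/-- Covariance of the short-time Fourier transform, up to a unimodular factor. -/
theorem norm_inner_gaborShift (g f : L2R) (p q : ℝ × ℝ) :
    ‖inner ℂ (gaborShift g p) (gaborShift f q)‖ = ‖inner ℂ (gaborShift g (p - q)) f‖ := by
  rw [inner_gaborShift, inner_gaborShift_left, ← integral_add_right_eq_self _ q.1]
  have h : ∀ t : ℝ, gaborFun f q (t + q.1) * (starRingEnd ℂ) (gaborFun g p (t + q.1))
      = Complex.exp ((2 * Real.pi * (q.2 - p.2) * q.1 : ℝ) * Complex.I) *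
        (f t * (starRingEnd ℂ) (gaborFun g (p - q) t)) := by
    intro t
    have h1 : t + q.1 - p.1 = t - (p - q).1 := by simp; ring
    simp only [gaborFun, h1, map_mul, add_sub_cancel_right, ← Complex.exp_conj, Complex.conj_ofReal,
      Complex.conj_I, map_ofNat]
    have h2 : Complex.exp (2 * Real.pi * Complex.I * q.2 * ↑(t + q.1)) *
        Complex.exp (2 * Real.pi * -Complex.I * p.2 * ↑(t + q.1))
        = Complex.exp ((2 * Real.pi * (q.2 - p.2) * q.1 : ℝ) * Complex.I) *
          Complex.exp (2 * Real.pi * -Complex.I * ↑(p - q).2 * t) := by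
      rw [← Complex.exp_add, ← Complex.exp_add]
      congr 1
      push_cast [Prod.snd_sub]
      ring
    linear_combination (f t * (starRingEnd ℂ) (g (t - (p - q).1))) * h2
  simp_rw [h]
  rw [integral_const_mul, norm_mul, Complex.norm_exp_ofReal_mul_I, one_mul]

theorem norm_gaborShift (g : L2R) (p : ℝ × ℝ) : ‖gaborShift g p‖ = ‖g‖ := by
  have h := norm_inner_gaborShift g g p p
  rw [sub_self, gaborShift_zero, inner_self_eq_norm_sq_to_K, inner_self_eq_norm_sq_to_K] at h
  simpa using h

/-- Exchanges window and function, at the price of a reflection of the plane. -/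
theorem norm_inner_gaborShift_neg (g f : L2R) (p : ℝ × ℝ) :
    ‖inner ℂ (gaborShift g (-p)) f‖ = ‖inner ℂ (gaborShift f p) g‖ := by
  rw [← zero_sub, ← norm_inner_gaborShift, gaborShift_zero, norm_inner_symm]

theorem gaborShift_sub (f g : L2R) (p : ℝ × ℝ) :
    gaborShift (f - g) p = gaborShift f p - gaborShift g p := by
  refine Lp.ext ?_
  have h1 : ∀ᵐ t, (f - g : L2R) (t - p.1) = f (t - p.1) - g (t - p.1) :=
    (measurePreserving_sub_right volume p.1).quasiMeasurePreserving.ae (Lp.coeFn_sub f g)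
  filter_upwards [coeFn_gaborShift (f - g) p, coeFn_gaborShift f p, coeFn_gaborShift g p,
    Lp.coeFn_sub (gaborShift f p) (gaborShift g p), h1] with t h2 h3 h4 h5 h6
  rw [h2, h5, Pi.sub_apply, h3, h4, gaborFun, gaborFun, gaborFun, h6, mul_sub]

theorem measurable_inner_gaborShift (g f : L2R) :
    Measurable fun p : ℝ × ℝ => (inner ℂ (gaborShift g p) f : ℂ) := by
  simp_rw [inner_gaborShift_left]
  refine (StronglyMeasurable.integral_prod_right' (ν := (volume : Measure ℝ))
    (f := fun x : (ℝ × ℝ) × ℝ => f x.2 * (starRingEnd ℂ) (gaborFun g x.1 x.2)) ?_).measurable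
  refine Measurable.stronglyMeasurable ?_
  have hf := (Lp.stronglyMeasurable f).measurable
  have hg := (Lp.stronglyMeasurable g).measurable
  have hc : Measurable (starRingEnd ℂ) := Complex.continuous_conj.measurable
  refine (hf.comp measurable_snd).mul (hc.comp (Measurable.mul ?_ (hg.comp ?_)))
  · refine Continuous.measurable ?_
    fun_prop
  · exact measurable_snd.sub measurable_fst.fst

theorem norm_sq_eq_integral (f : L2R) : ‖f‖ ^ 2 = ∫ t, ‖f t‖ ^ 2 := by
  have h : (inner ℂ f f : ℂ) = ∫ t, ((‖f t‖ ^ 2 : ℝ) : ℂ) := by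
    rw [L2.inner_def]
    refine integral_congr_ae (Eventually.of_forall fun t => ?_)
    simp only [inner_self_eq_norm_sq_to_K]
    norm_cast
  rw [inner_self_eq_norm_sq_to_K, integral_complex_ofReal] at h
  refine Complex.ofReal_injective ?_
  rw [← h]
  simp

theorem tendsto_modulation (f : L2R) :
    Tendsto (fun b : ℝ => gaborShift f (0, b)) (𝓝 0) (𝓝 f) := by
  rw [tendsto_iff_norm_sub_tendsto_zero]
  have key : ∀ b : ℝ, ‖gaborShift f (0, b) - f‖ ^ 2
      = ∫ t : ℝ, ‖Complex.exp (2 * Real.pi * Complex.I * b * t) * f t - f t‖ ^ 2 := by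
    intro b
    rw [norm_sq_eq_integral]
    refine integral_congr_ae ?_
    filter_upwards [coeFn_gaborShift f (0, b), Lp.coeFn_sub (gaborShift f (0, b)) f] with t h1 h2
    rw [h2, Pi.sub_apply, h1, gaborFun]
    simp
  have h2 : Tendsto (fun b : ℝ => ‖gaborShift f (0, b) - f‖ ^ 2) (𝓝 0) (𝓝 0) := by
    simp_rw [key]
    have := tendsto_integral_filter_of_dominated_convergence (μ := (volume : Measure ℝ))
      (l := 𝓝 (0 : ℝ)) (f := fun _ => (0 : ℝ))
      (F := fun b t => ‖Complex.exp (2 * Real.pi * Complex.I * b * t) * f t - f t‖ ^ 2)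
      -- Dominated convergence: the modulation factor is unimodular, so the difference is at most `2
      -- * ‖f t‖`.
      (fun t => 4 * ‖f t‖ ^ 2) ?_ ?_ ?_ ?_
    · simpa using this
    · refine Eventually.of_forall fun b => AEStronglyMeasurable.pow (.norm ?_) 2
      refine AEStronglyMeasurable.sub (.mul ?_ (Lp.aestronglyMeasurable f))
        (Lp.aestronglyMeasurable f)
      exact Continuous.aestronglyMeasurable (by fun_prop)
    · refine Eventually.of_forall fun b => Eventually.of_forall fun t => ?_
      have h3 : (2 * Real.pi * Complex.I * b * t : ℂ)
          = ((2 * Real.pi * b * t : ℝ) : ℂ) * Complex.I := by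
        push_cast; ring
      have h4 := norm_sub_le (Complex.exp (2 * Real.pi * Complex.I * b * t) * f t) (f t)
      rw [norm_mul, h3, Complex.norm_exp_ofReal_mul_I, one_mul] at h4
      rw [norm_pow, norm_norm, h3]
      nlinarith [norm_nonneg (Complex.exp (((2 * Real.pi * b * t : ℝ) : ℂ) * Complex.I) * f t - f t)]
    · exact ((Lp.memLp f).integrable_norm_pow (by norm_num)).const_mul 4
    · refine Eventually.of_forall fun t => ?_
      have : Continuous fun b : ℝ =>
          ‖Complex.exp (2 * Real.pi * Complex.I * b * t) * f t - f t‖ ^ 2 := by fun_prop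
      simpa using this.tendsto 0
  simpa [Function.comp_def] using (Real.continuous_sqrt.tendsto 0).comp h2

theorem tendsto_translation (f : L2R) :
    Tendsto (fun a : ℝ => gaborShift f (a, 0)) (𝓝 0) (𝓝 f) := by
  have h : ∀ a : ℝ, gaborShift f (a, 0) = DomAddAct.mk (-a) +ᵥ f := by
    intro a
    refine Lp.ext ?_
    filter_upwards [coeFn_gaborShift f (a, 0), DomAddAct.vadd_Lp_ae_eq (DomAddAct.mk (-a)) f]
      with t h1 h2
    rw [h1, h2, gaborFun]
    simp [sub_eq_neg_add]
  simp_rw [h]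
  have : Fact ((2 : ENNReal) ≠ ⊤) := ⟨by simp⟩
  have hc : Continuous fun a : ℝ => DomAddAct.mk (-a) +ᵥ f :=
    (DomAddAct.continuous_mk.comp continuous_neg).vadd continuous_const
  have := hc.tendsto 0
  simpa using this

/-- A shift is a translation followed by a modulation; the modulation is isometric, so the two
errors add. -/
theorem tendsto_gaborShift_zero (f : L2R) :
    Tendsto (fun p : ℝ × ℝ => gaborShift f p) (𝓝 0) (𝓝 f) := by
  have hdecomp : ∀ p : ℝ × ℝ, gaborShift f p = gaborShift (gaborShift f (p.1, 0)) (0, p.2) := by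
    intro p
    refine Lp.ext ?_
    filter_upwards [coeFn_gaborShift f p, coeFn_gaborShift (gaborShift f (p.1, 0)) (0, p.2),
      coeFn_gaborShift f (p.1, 0)] with t h1 h2 h3
    rw [h1, h2, gaborFun, gaborFun, sub_zero, h3, gaborFun]
    simp
  have h1 := (tendsto_iff_norm_sub_tendsto_zero.1 (tendsto_translation f)).comp
    (continuous_fst.tendsto (0 : ℝ × ℝ))
  have h2 := (tendsto_iff_norm_sub_tendsto_zero.1 (tendsto_modulation f)).comp
    (continuous_snd.tendsto (0 : ℝ × ℝ))
  rw [tendsto_iff_norm_sub_tendsto_zero]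
  refine squeeze_zero (fun _ => norm_nonneg _) (fun p => ?_) (by simpa using h1.add h2)
  have h3 : gaborShift f p - f =
      gaborShift (gaborShift f (p.1, 0) - f) (0, p.2) + (gaborShift f (0, p.2) - f) := by
    rw [hdecomp p, gaborShift_sub]; abel
  rw [h3]
  refine (norm_add_le _ _).trans ?_
  rw [norm_gaborShift]

end Shifts

/-! ### The reference Gabor basis and square integrability of coefficients -/

section UnitBasis

/-- The indicator function of the interval `(0, 1]`. -/
def unitWindow : L2R :=
  indicatorConstLp 2 (measurableSet_Ioc (a := (0 : ℝ)) (b := 1)) (by simp) (1 : ℂ)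

/-- The point of the plane with the given integer coordinates. -/
def latticePoint (j : ℤ × ℤ) : ℝ × ℝ := (j.1, j.2)

/-- The Gabor basis of `L²(ℝ)` with window `1_{(0, 1]}` over `ℤ²`. -/
def unitBasis (j : ℤ × ℤ) : L2R := gaborShift unitWindow (latticePoint j)

theorem inner_unitBasis (m n : ℤ) (f : L2R) :
    (inner ℂ (unitBasis (m, n)) f : ℂ) = fourierCoeffOn (lt_add_one (m : ℝ)) f n := by
  rw [unitBasis, inner_gaborShift_left, fourierCoeffOn_eq_integral, add_sub_cancel_left, div_one,
    one_smul, intervalIntegral.integral_of_le (lt_add_one (m : ℝ)).le,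
    ← integral_indicator measurableSet_Ioc]
  refine integral_congr_ae ?_
  have h : ∀ᵐ t : ℝ, unitWindow (t - m) = (Set.Ioc (0 : ℝ) 1).indicator (fun _ => 1) (t - m) :=
    (measurePreserving_sub_right volume (m : ℝ)).quasiMeasurePreserving.ae
      indicatorConstLp_coeFn
  filter_upwards [h] with t ht
  simp only [gaborFun, latticePoint, ht]
  by_cases hm : t ∈ Set.Ioc (m : ℝ) (m + 1)
  · rw [Set.indicator_of_mem hm, Set.indicator_of_mem (by
      simp only [Set.mem_Ioc] at hm ⊢; constructor <;> linarith), fourier_coe_apply, mul_one,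
      ← Complex.exp_conj, smul_eq_mul, mul_comm]
    congr 2
    simp [map_ofNat]
  · rw [Set.indicator_of_notMem hm, Set.indicator_of_notMem (by
      simp only [Set.mem_Ioc] at hm ⊢; contrapose! hm; constructor <;> linarith)]
    simp

theorem enorm_sq_eq_lintegral (f : L2R) : ‖f‖ₑ ^ 2 = ∫⁻ t, ‖f t‖ₑ ^ 2 := by
  have h := (Lp.memLp f).integrable_norm_pow (by norm_num)
  rw [← ofReal_norm, ← ENNReal.ofReal_pow (norm_nonneg _), norm_sq_eq_integral,
    ofReal_integral_eq_lintegral_ofReal (by simpa using h)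
      (Eventually.of_forall fun t => by positivity)]
  refine lintegral_congr fun t => ?_
  rw [ENNReal.ofReal_pow (norm_nonneg _), ofReal_norm]

/-- Parseval for Fourier series on each interval `(m, m + 1]`, summed over `m`. -/
theorem tsum_enorm_inner_unitBasis (f : L2R) :
    ∑' j, ‖(inner ℂ (unitBasis j) f : ℂ)‖ₑ ^ 2 = ‖f‖ₑ ^ 2 := by
  have h1 : ∀ m : ℤ, ∑' n, ‖(inner ℂ (unitBasis (m, n)) f : ℂ)‖ₑ ^ 2
      = ∫⁻ t in Set.Ioc (m : ℝ) (m + 1), ‖f t‖ₑ ^ 2 := by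
    intro m
    have h2 : MemLp f 2 (volume.restrict (Set.Ioc (m : ℝ) (m + 1))) := (Lp.memLp f).restrict _
    have h3 := hasSum_sq_fourierCoeffOn (lt_add_one (m : ℝ)) h2
    simp_rw [← inner_unitBasis] at h3
    rw [add_sub_cancel_left, inv_one, one_smul,
      intervalIntegral.integral_of_le (lt_add_one (m : ℝ)).le] at h3
    have h4 : ∀ n, ‖(inner ℂ (unitBasis (m, n)) f : ℂ)‖ₑ ^ 2
        = ENNReal.ofReal (‖(inner ℂ (unitBasis (m, n)) f : ℂ)‖ ^ 2) := fun n => by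
      rw [ENNReal.ofReal_pow (norm_nonneg _), ofReal_norm]
    simp_rw [h4]
    rw [← ENNReal.ofReal_tsum_of_nonneg (fun n => by positivity) h3.summable, h3.tsum_eq,
      ofReal_integral_eq_lintegral_ofReal (by simpa using h2.integrable_norm_pow (by norm_num))
        (Eventually.of_forall fun t => by positivity)]
    refine lintegral_congr fun t => ?_
    rw [ENNReal.ofReal_pow (norm_nonneg _), ofReal_norm]
  rw [ENNReal.tsum_prod']
  simp_rw [h1]
  rw [← lintegral_iUnion (fun m => measurableSet_Ioc) (Set.pairwise_disjoint_Ioc_intCast ℝ),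
    iUnion_Ioc_intCast, Measure.restrict_univ, enorm_sq_eq_lintegral]

theorem norm_unitBasis (j : ℤ × ℤ) : ‖unitBasis j‖ = 1 := by
  rw [unitBasis, norm_gaborShift, unitWindow, norm_indicatorConstLp (by simp) (by simp)]
  simp

/-- Parseval applied to the unit vector `unitBasis j`: the term `k = j` already equals `1`, so all
other terms vanish. -/
theorem orthonormal_unitBasis : Orthonormal ℂ unitBasis := by
  refine ⟨norm_unitBasis, fun i j hij => ?_⟩
  have h := tsum_enorm_inner_unitBasis (unitBasis j)
  have h1 : ‖unitBasis j‖ₑ = 1 := by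
    rw [← ofReal_norm, norm_unitBasis, ENNReal.ofReal_one]
  have h2 := ENNReal.sum_le_tsum (f := fun k => ‖(inner ℂ (unitBasis k) (unitBasis j) : ℂ)‖ₑ ^ 2)
    {i, j}
  rw [h, Finset.sum_pair hij, inner_self_eq_norm_sq_to_K, norm_unitBasis, h1] at h2
  have h3 : ‖(inner ℂ (unitBasis i) (unitBasis j) : ℂ)‖ₑ ^ 2 = 0 := by
    have : ‖(inner ℂ (unitBasis i) (unitBasis j) : ℂ)‖ₑ ^ 2 + 1 ≤ 0 + 1 := by simpa using h2
    simpa using (ENNReal.add_le_add_iff_right ENNReal.one_ne_top).1 this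
  simpa using h3

theorem enorm_inner_gaborShift (g f : L2R) (p q : ℝ × ℝ) :
    ‖(inner ℂ (gaborShift g p) (gaborShift f q) : ℂ)‖ₑ
      = ‖(inner ℂ (gaborShift g (p - q)) f : ℂ)‖ₑ := by
  rw [← ofReal_norm, ← ofReal_norm, norm_inner_gaborShift]

theorem enorm_gaborShift (g : L2R) (p : ℝ × ℝ) : ‖gaborShift g p‖ₑ = ‖g‖ₑ := by
  rw [← ofReal_norm, ← ofReal_norm, norm_gaborShift]

/-- Fold the integral over the plane onto the unit square: at each `v` the sum over `v + ℤ²` is, by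
covariance, the Parseval sum of a shift of `f`, hence `‖f‖ₑ ^ 2`. -/
theorem lintegral_inner_unitWindow_le (f : L2R) :
    ∫⁻ u, ‖(inner ℂ (gaborShift unitWindow u) f : ℂ)‖ₑ ^ 2 ≤ ‖f‖ₑ ^ 2 := by
  set F : ℝ × ℝ → ENNReal := fun u => ‖(inner ℂ (gaborShift unitWindow u) f : ℂ)‖ₑ ^ 2
  have hF : Measurable F := (measurable_inner_gaborShift _ _).enorm.pow_const 2
  set S : Set (ℝ × ℝ) := Set.Ico 0 1 ×ˢ Set.Ico 0 1
  have hS : MeasurableSet S := measurableSet_Ico.prod measurableSet_Ico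
  have hFj : ∀ j, Measurable fun v => F (v + latticePoint j) := fun j =>
    hF.comp (measurable_add_const _)
  have hcover : ∀ u, F u ≤ ∑' j, S.indicator (fun v => F (v + latticePoint j))
      (u - latticePoint j) := by
    intro u
    refine le_trans ?_ (ENNReal.le_tsum (⌊u.1⌋, ⌊u.2⌋))
    rw [Set.indicator_of_mem]
    · simp
    · refine ⟨⟨?_, ?_⟩, ⟨?_, ?_⟩⟩ <;> simp only [latticePoint, Prod.fst_sub, Prod.snd_sub]
      · exact Int.fract_nonneg _
      · exact Int.fract_lt_one _
      · exact Int.fract_nonneg _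
      · exact Int.fract_lt_one _
  have hsum : ∀ v, ∑' j, F (v + latticePoint j) = ‖f‖ₑ ^ 2 := by
    intro v
    rw [← enorm_gaborShift f (-v), ← tsum_enorm_inner_unitBasis]
    refine tsum_congr fun j => ?_
    simp only [F, unitBasis]
    rw [enorm_inner_gaborShift, sub_neg_eq_add, add_comm]
  calc ∫⁻ u, F u ≤ ∫⁻ u, ∑' j, S.indicator (fun v => F (v + latticePoint j))
        (u - latticePoint j) := lintegral_mono hcover
    _ = ∑' j, ∫⁻ u, S.indicator (fun v => F (v + latticePoint j)) (u - latticePoint j) :=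
        lintegral_tsum fun j =>
          (((hFj j).indicator hS).comp (measurable_sub_const _)).aemeasurable
    _ = ∑' j, ∫⁻ u in S, F (u + latticePoint j) := by
        refine tsum_congr fun j => ?_
        rw [lintegral_sub_right_eq_self (fun u => S.indicator (fun v => F (v + latticePoint j)) u),
          lintegral_indicator hS]
    _ = ∫⁻ u in S, ∑' j, F (u + latticePoint j) :=
        (lintegral_tsum fun j => (hFj j).aemeasurable).symm
    _ = ‖f‖ₑ ^ 2 := by
        simp_rw [hsum]
        rw [setLIntegral_const, Measure.volume_eq_prod, Measure.prod_prod]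
        simp

theorem lintegral_inner_gaborShift_unitWindow_le (g : L2R) :
    ∫⁻ u, ‖(inner ℂ (gaborShift g u) unitWindow : ℂ)‖ₑ ^ 2 ≤ ‖g‖ₑ ^ 2 := by
  refine le_of_eq_of_le ?_ (lintegral_inner_unitWindow_le g)
  rw [← lintegral_neg_eq_self (fun u => ‖(inner ℂ (gaborShift g u) unitWindow : ℂ)‖ₑ ^ 2)]
  refine lintegral_congr fun u => ?_
  rw [← ofReal_norm, norm_inner_gaborShift_neg, ofReal_norm]

end UnitBasis

/-! ### The homogeneous approximation property -/

section Tails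

theorem enorm_add_sq_le (x y : ℂ) : ‖x + y‖ₑ ^ 2 ≤ 2 * ‖x‖ₑ ^ 2 + 2 * ‖y‖ₑ ^ 2 := by
  have h : ‖x + y‖₊ ^ 2 ≤ 2 * ‖x‖₊ ^ 2 + 2 * ‖y‖₊ ^ 2 := by
    rw [← NNReal.coe_le_coe]
    push_cast
    have := norm_add_le x y
    nlinarith [norm_nonneg (x + y), norm_nonneg x, norm_nonneg y, sq_nonneg (‖x‖ - ‖y‖)]
  simp only [enorm_eq_nnnorm]
  exact_mod_cast h

theorem exists_lintegral_compl_square_le {F : ℝ × ℝ → ENNReal} (hF : ∫⁻ u, F u ≠ ⊤)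
    {ε : ENNReal} (hε : ε ≠ 0) :
    ∃ n : ℕ, ∫⁻ u in (square 0 n)ᶜ, F u ≤ ε := by
  have hmeas : ∀ n : ℕ, MeasurableSet (square 0 n)ᶜ := fun n =>
    (((measurable_fst.sub_const _).abs measurableSet_Iic).inter
      ((measurable_snd.sub_const _).abs measurableSet_Iic)).compl
  have hlim : Tendsto (fun n : ℕ => volume.withDensity F (square 0 n)ᶜ) atTop (𝓝 0) := by
    have h1 : ⋂ n : ℕ, (square 0 n)ᶜ = ∅ := by
      refine Set.eq_empty_of_forall_notMem fun x hx => ?_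
      obtain ⟨n, hn⟩ := exists_nat_ge (max |x.1| |x.2|)
      refine Set.mem_iInter.1 hx n ?_
      simpa [mem_square] using hn
    rw [← measure_empty (μ := volume.withDensity F), ← h1]
    refine tendsto_measure_iInter_atTop (fun n => (hmeas n).nullMeasurableSet) ?_ ⟨0, ?_⟩
    · intro m n hmn x hx hx'
      have hmn' : (m : ℝ) ≤ n := by exact_mod_cast hmn
      exact hx ⟨hx'.1.trans hmn', hx'.2.trans hmn'⟩
    · rw [withDensity_apply _ (hmeas 0)]
      exact ne_top_of_le_ne_top hF (setLIntegral_le_lintegral _ _)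
  obtain ⟨n, hn⟩ := (hlim.eventually_le_const (pos_iff_ne_zero.2 hε)).exists
  exact ⟨n, by rwa [withDensity_apply _ (hmeas n)] at hn⟩

/-- The small squares `x k - p - [0, ρ]²` attached to a separated family are disjoint, so that
the integrals of `F` over those with `x k` outside `square p (n + 1)` add up to at most the
integral over the complement of `square 0 n`. -/
theorem tsum_setLIntegral_le {κ : Type*} [Countable κ] {x : κ → ℝ × ℝ} {δ ρ : ℝ}
    (hx : ∀ k l, k ≠ l → δ < √(((x k).1 - (x l).1) ^ 2 + ((x k).2 - (x l).2) ^ 2))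
    (hρ0 : 0 ≤ ρ) (hρ1 : ρ ≤ 1) (hρδ : 2 * ρ ≤ δ) {F : ℝ × ℝ → ENNReal} (hF : Measurable F)
    (p : ℝ × ℝ) (n : ℕ) :
    ∑' k, {k | x k ∉ square p (n + 1)}.indicator
        (fun k => ∫⁻ u in Set.Icc 0 ρ ×ˢ Set.Icc 0 ρ, F (x k - p - u)) k
      ≤ ∫⁻ u in (square 0 n)ᶜ, F u := by
  classical
  set S : Set (ℝ × ℝ) := Set.Icc 0 ρ ×ˢ Set.Icc 0 ρ
  have hS : MeasurableSet S := measurableSet_Icc.prod measurableSet_Icc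
  have hmeas : MeasurableSet (square 0 n)ᶜ :=
    (((measurable_fst.sub_const _).abs measurableSet_Iic).inter
      ((measurable_snd.sub_const _).abs measurableSet_Iic)).compl
  set G : κ → ℝ × ℝ → ENNReal := fun k =>
    {v | x k ∉ square p (n + 1) ∧ x k - p - v ∈ S}.indicator F
  have hG : ∀ k, Measurable (G k) := fun k => hF.indicator
    ((MeasurableSet.const _).inter ((measurable_const.sub measurable_id) hS))
  have h1 : ∀ k, {k | x k ∉ square p (n + 1)}.indicator
        (fun k => ∫⁻ u in S, F (x k - p - u)) k = ∫⁻ v, G k v := by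
    intro k
    by_cases hk : x k ∉ square p (n + 1)
    · rw [Set.indicator_of_mem (by exact hk), ← lintegral_indicator hS,
        ← lintegral_sub_left_eq_self (G k) (x k - p)]
      refine lintegral_congr fun u => ?_
      by_cases hu : u ∈ S <;> simp [G, Set.indicator, hk, hu]
    · rw [Set.indicator_of_notMem (by exact hk)]
      simp [G, hk]
  simp_rw [h1]
  rw [← lintegral_tsum fun k => (hG k).aemeasurable, ← lintegral_indicator hmeas]
  refine lintegral_mono fun v => ?_
  by_cases h : ∃ k, x k ∉ square p (n + 1) ∧ x k - p - v ∈ S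
  · obtain ⟨k, hk, hkv⟩ := h
    have hsingle : ∀ l, l ≠ k → G l v = 0 := by
      intro l hl
      -- Two points `x l`, `x k` whose small squares both contain `v` differ by at most `ρ` in each
      -- coordinate, against `2 * ρ ≤ δ`.
      refine Set.indicator_of_notMem ?_ _
      rintro ⟨-, hlv⟩
      obtain ⟨⟨a1, a2⟩, b1, b2⟩ := hkv
      obtain ⟨⟨c1, c2⟩, d1, d2⟩ := hlv
      simp only [Prod.fst_sub, Prod.snd_sub] at a1 a2 b1 b2 c1 c2 d1 d2
      have h2 := hx l k hl
      rw [Real.lt_sqrt (by linarith)] at h2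
      have h3 : ((x l).1 - (x k).1) ^ 2 ≤ ρ ^ 2 := sq_le_sq' (by linarith) (by linarith)
      have h4 : ((x l).2 - (x k).2) ^ 2 ≤ ρ ^ 2 := sq_le_sq' (by linarith) (by linarith)
      nlinarith
    rw [tsum_eq_single k hsingle]
    refine (Set.indicator_le_self _ _ _).trans ?_
    rw [Set.indicator_of_mem]
    -- Since `ρ ≤ 1`, a point `v` in `square 0 n` would force `x k` into `square p (n + 1)`.
    intro hv
    refine hk ?_
    obtain ⟨⟨a1, a2⟩, b1, b2⟩ := hkv
    obtain ⟨c1, c2⟩ := hv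
    simp only [Prod.fst_sub, Prod.snd_sub, Prod.fst_zero, Prod.snd_zero, sub_zero, abs_le]
      at a1 a2 b1 b2 c1 c2
    rw [mem_square, abs_le, abs_le]
    refine ⟨⟨?_, ?_⟩, ?_, ?_⟩ <;> linarith
  · push Not at h
    have : ∀ k, G k v = 0 := fun k => Set.indicator_of_notMem (fun hk => h k hk.1 hk.2) _
    simp [this]

/-- The homogeneous approximation property: the tails of the coefficients of `gaborShift f p` are
small uniformly in `p`. -/
theorem exists_tail_le {κ : Type*} [Countable κ] {x : κ → ℝ × ℝ} {δ : ℝ} (hδ : 0 < δ)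
    (hx : ∀ k l, k ≠ l → δ < √(((x k).1 - (x l).1) ^ 2 + ((x k).2 - (x l).2) ^ 2))
    {g f : L2R} {B : ENNReal} (hB : B ≠ ⊤)
    (hbessel : ∀ y : L2R, ∑' k, ‖(inner ℂ (gaborShift g (x k)) y : ℂ)‖ₑ ^ 2 ≤ B * ‖y‖ₑ ^ 2)
    (hint : ∫⁻ u, ‖(inner ℂ (gaborShift g u) f : ℂ)‖ₑ ^ 2 ≠ ⊤) {ε : ENNReal} (hε : ε ≠ 0) :
    ∃ R : ℝ, 0 < R ∧ ∀ p, ∑' k, {k | x k ∉ square p R}.indicator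
      (fun k => ‖(inner ℂ (gaborShift g (x k)) (gaborShift f p) : ℂ)‖ₑ ^ 2) k ≤ ε := by
  set F : ℝ × ℝ → ENNReal := fun u => ‖(inner ℂ (gaborShift g u) f : ℂ)‖ₑ ^ 2
  have hF : Measurable F := (measurable_inner_gaborShift _ _).enorm.pow_const 2
  have hε2 : ε / 2 ≠ 0 := by simpa using hε
  -- Replacing `f` by `gaborShift f u` with `u` small changes all coefficients, in total square sum,
  -- by little: this is the Bessel bound with strong continuity. Averaging over such `u` replaces
  -- point values of `F` by integrals.
  have hlim : Tendsto (fun u => 2 * (B * ‖f - gaborShift f u‖ₑ ^ 2)) (𝓝 0) (𝓝 0) := by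
    have h1 : Tendsto (fun u => ‖f - gaborShift f u‖ₑ) (𝓝 0) (𝓝 0) := by
      have := ((tendsto_gaborShift_zero f).const_sub f).enorm
      simpa using this
    have h2 := ENNReal.Tendsto.const_mul (a := 2) (ENNReal.Tendsto.const_mul (a := B)
      (ENNReal.Tendsto.pow (n := 2) h1) (Or.inr hB)) (Or.inr (by simp))
    simpa using h2
  obtain ⟨r, hr, hball⟩ := Metric.eventually_nhds_iff_ball.1
    (hlim.eventually_le_const (pos_iff_ne_zero.2 hε2))
  obtain ⟨ρ, hρ, hρr, hρ1, hρδ⟩ : ∃ ρ : ℝ, 0 < ρ ∧ ρ < r ∧ ρ ≤ 1 ∧ 2 * ρ ≤ δ := by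
    refine ⟨min (r / 2) (min 1 (δ / 2)), by positivity, ?_, ?_, ?_⟩
    · exact (min_le_left _ _).trans_lt (by linarith)
    · exact (min_le_right _ _).trans (min_le_left _ _)
    · have := (min_le_right (r / 2) _).trans (min_le_right 1 (δ / 2))
      linarith
  set S : Set (ℝ × ℝ) := Set.Icc 0 ρ ×ˢ Set.Icc 0 ρ
  have hS : MeasurableSet S := measurableSet_Icc.prod measurableSet_Icc
  have hSvol : volume S = ENNReal.ofReal ρ * ENNReal.ofReal ρ := by
    rw [Measure.volume_eq_prod, Measure.prod_prod]
    simp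
  have hS0 : volume S ≠ 0 := by simp [hSvol, hρ]
  have hStop : volume S ≠ ⊤ := by rw [hSvol]; finiteness
  -- The target `ε * volume S / 4` is doubled by the factor `2` in `hXY`; it then fills the half of
  -- `ε` left by the first error.
  obtain ⟨n, hn⟩ := exists_lintegral_compl_square_le hint
    (ε := ε / 2 * volume S / 2) (by simp [hε, hS0])
  refine ⟨n + 1, by positivity, fun p => ?_⟩
  set X := ∑' k, {k | x k ∉ square p (n + 1)}.indicator
      (fun k => ‖(inner ℂ (gaborShift g (x k)) (gaborShift f p) : ℂ)‖ₑ ^ 2) k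
  set Y : ℝ × ℝ → ENNReal := fun u => ∑' k, {k | x k ∉ square p (n + 1)}.indicator
      (fun k => F (x k - p - u)) k
  have hXY : ∀ u ∈ S, X ≤ ε / 2 + 2 * Y u := by
    intro u hu
    have hu' : u ∈ Metric.ball (0 : ℝ × ℝ) r := by
      obtain ⟨⟨a1, a2⟩, b1, b2⟩ := hu
      rw [mem_ball_zero_iff, Prod.norm_def, max_lt_iff, Real.norm_eq_abs, Real.norm_eq_abs,
        abs_of_nonneg a1, abs_of_nonneg b1]
      constructor <;> linarith
    have h1 : ∀ k, ‖(inner ℂ (gaborShift g (x k)) (gaborShift f p) : ℂ)‖ₑ ^ 2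
        ≤ 2 * ‖(inner ℂ (gaborShift g (x k)) (gaborShift (f - gaborShift f u) p) : ℂ)‖ₑ ^ 2
          + 2 * F (x k - p - u) := by
      intro k
      -- Covariance, used twice, leaves only the dependence on `x k - p - u`; this makes the radius
      -- uniform in `p`.
      have h2 : ‖(inner ℂ (gaborShift g (x k)) (gaborShift (gaborShift f u) p) : ℂ)‖ₑ ^ 2
          = F (x k - p - u) := by
        rw [enorm_inner_gaborShift, enorm_inner_gaborShift]
      rw [← h2]
      refine le_trans (le_of_eq ?_) (enorm_add_sq_le _ _)
      rw [← inner_add_right, gaborShift_sub, sub_add_cancel]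
    calc X ≤ ∑' k, (2 * ‖(inner ℂ (gaborShift g (x k))
              (gaborShift (f - gaborShift f u) p) : ℂ)‖ₑ ^ 2
            + 2 * {k | x k ∉ square p (n + 1)}.indicator (fun k => F (x k - p - u)) k) := by
          refine ENNReal.tsum_le_tsum fun k => ?_
          by_cases hk : k ∈ {k | x k ∉ square p (n + 1)}
          · rw [Set.indicator_of_mem hk, Set.indicator_of_mem hk]
            exact h1 k
          · rw [Set.indicator_of_notMem hk]
            exact zero_le
      _ ≤ 2 * (B * ‖f - gaborShift f u‖ₑ ^ 2) + 2 * Y u := by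
          rw [ENNReal.tsum_add, ENNReal.tsum_mul_left, ENNReal.tsum_mul_left]
          gcongr
          refine (hbessel _).trans ?_
          rw [enorm_gaborShift]
      _ ≤ _ := by
          gcongr
          exact hball u hu'
  have hFk : ∀ k, Measurable fun u => F (x k - p - u) := fun k =>
    hF.comp (measurable_const.sub measurable_id)
  have hYk : ∀ k, Measurable fun u =>
      {k | x k ∉ square p (n + 1)}.indicator (fun k => F (x k - p - u)) k := by
    intro k
    by_cases hk : k ∈ {k | x k ∉ square p (n + 1)}
    · simpa only [Set.indicator_of_mem hk] using hFk k
    · simp only [Set.indicator_of_notMem hk, measurable_const]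
  have hY : ∫⁻ u in S, Y u ≤ ε / 2 * volume S / 2 := by
    rw [lintegral_tsum fun k => (hYk k).aemeasurable]
    refine le_trans (le_of_eq (tsum_congr fun k => ?_))
      ((tsum_setLIntegral_le hx hρ.le hρ1 hρδ hF p n).trans hn)
    by_cases hk : k ∈ {k | x k ∉ square p (n + 1)}
    · simp only [Set.indicator_of_mem hk, S]
    · simp only [Set.indicator_of_notMem hk, lintegral_zero]
  have hfin : X * volume S ≤ ε * volume S := by
    calc X * volume S = ∫⁻ _ in S, X := by rw [setLIntegral_const]
      _ ≤ ∫⁻ u in S, (ε / 2 + 2 * Y u) := setLIntegral_mono' hS hXY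
      _ = ε / 2 * volume S + 2 * ∫⁻ u in S, Y u := by
          rw [lintegral_add_left measurable_const, setLIntegral_const,
            lintegral_const_mul _ (Measurable.tsum hYk)]
      _ ≤ ε / 2 * volume S + 2 * (ε / 2 * volume S / 2) := by gcongr
      _ = (ε / 2 + ε / 2) * volume S := by
          rw [ENNReal.mul_div_cancel (by simp) (by simp), add_mul]
      _ = ε * volume S := by rw [ENNReal.add_halves]
  exact (ENNReal.mul_le_mul_iff_left hS0 hStop).1 hfin

end Tails

/-! ### Dimension count and finite sections -/

section Comparison

/-- If the rows `c k` have a lower frame bound `A` and those with `k ∉ I` have columns of small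
norm, then `I` has almost as many elements as there are columns. -/
theorem mul_card_sub_card_le {ι κ : Type*} [Fintype ι] [DecidableEq ι] (c : κ → ι → ℂ)
    {A η : ℝ} (hA : 0 ≤ A) (hη : 0 ≤ η)
    (hlower : ∀ a : EuclideanSpace ℂ ι,
      ENNReal.ofReal (A * ‖a‖ ^ 2) ≤ ∑' k, ‖∑ i, a i * c k i‖ₑ ^ 2)
    (I : Finset κ)
    (htail : ∀ i, ∑' k, {k | k ∉ I}.indicator (fun k => ‖c k i‖ₑ ^ 2) k ≤ ENNReal.ofReal η) :
    A * (Fintype.card ι - I.card) ≤ Fintype.card ι * η := by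
  set w : κ → EuclideanSpace ℂ ι := fun k => WithLp.toLp 2 fun i => (starRingEnd ℂ) (c k i)
  have hw : ∀ k (a : EuclideanSpace ℂ ι), ∑ i, a i * c k i = inner ℂ (w k) a := by
    intro k a
    simp [w, PiLp.inner_apply, mul_comm]
  set T : EuclideanSpace ℂ ι →ₗ[ℂ] (I → ℂ) :=
    LinearMap.pi fun k => (innerSL ℂ (w k)).toLinearMap
  -- `U` consists of the coefficient vectors invisible to the rows in `I`; by rank-nullity its
  -- dimension is at least the number of columns minus `I.card`.
  set U := LinearMap.ker T
  set b := stdOrthonormalBasis ℂ U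
  set d := Module.finrank ℂ U
  have hd : Fintype.card ι ≤ I.card + d := by
    have h1 : Module.finrank ℂ (LinearMap.range T) + d = _ :=
      LinearMap.finrank_range_add_finrank_ker T
    have h2 : Module.finrank ℂ (LinearMap.range T) ≤ I.card :=
      (Submodule.finrank_le _).trans (by simp)
    rw [finrank_euclideanSpace] at h1
    omega
  have hzero : ∀ l, ∀ k ∈ I, (inner ℂ (w k) (b l : EuclideanSpace ℂ ι) : ℂ) = 0 := by
    intro l k hk
    exact congrFun (LinearMap.mem_ker.1 (b l).2) ⟨k, hk⟩
  have hb : Orthonormal ℂ fun l => (b l : EuclideanSpace ℂ ι) :=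
    b.orthonormal.comp_linearIsometry U.subtypeₗᵢ
  -- Bessel's inequality for the orthonormal basis of `U`, applied to the row `w k`.
  have hsum : ∀ k, ∑ l, ‖(inner ℂ (w k) (b l : EuclideanSpace ℂ ι) : ℂ)‖ₑ ^ 2
      ≤ ∑ i, ‖c k i‖ₑ ^ 2 := by
    intro k
    have h1 := hb.sum_inner_products_le (w k) (s := Finset.univ)
    have h2 : ‖w k‖ ^ 2 = ∑ i, ‖c k i‖ ^ 2 := by
      simp [EuclideanSpace.norm_sq_eq, w]
    rw [h2] at h1
    have h3 := ENNReal.ofReal_le_ofReal h1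
    rw [ENNReal.ofReal_sum_of_nonneg fun _ _ => by positivity,
      ENNReal.ofReal_sum_of_nonneg fun _ _ => by positivity] at h3
    simp_rw [ENNReal.ofReal_pow (norm_nonneg _), ofReal_norm] at h3
    refine le_of_eq_of_le (Finset.sum_congr rfl fun l _ => ?_) h3
    rw [← ofReal_norm, norm_inner_symm, ofReal_norm]
  -- Sum the lower bound over an orthonormal basis of `U`. Rows in `I` contribute nothing; the
  -- others are bounded by Bessel, then by the column tails.
  have hmain : (d : ENNReal) * ENNReal.ofReal A ≤ Fintype.card ι * ENNReal.ofReal η := by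
    calc (d : ENNReal) * ENNReal.ofReal A = ∑ _l : Fin d, ENNReal.ofReal A := by simp
      _ ≤ ∑ l : Fin d, ∑' k, ‖(inner ℂ (w k) (b l : EuclideanSpace ℂ ι) : ℂ)‖ₑ ^ 2 := by
          refine Finset.sum_le_sum fun l _ => ?_
          have h1 := hlower (b l)
          have h2 : ‖(b l : EuclideanSpace ℂ ι)‖ = 1 := hb.norm_eq_one l
          simp_rw [hw] at h1
          simpa [h2] using h1
      _ = ∑' k, ∑ l : Fin d, ‖(inner ℂ (w k) (b l : EuclideanSpace ℂ ι) : ℂ)‖ₑ ^ 2 :=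
          (Summable.tsum_finsetSum fun _ _ => ENNReal.summable).symm
      _ ≤ ∑' k, ∑ i, {k | k ∉ I}.indicator (fun k => ‖c k i‖ₑ ^ 2) k := by
          refine ENNReal.tsum_le_tsum fun k => ?_
          by_cases hk : k ∈ I
          · simp [hzero _ k hk]
          · simpa [Set.indicator, hk] using hsum k
      _ = ∑ i, ∑' k, {k | k ∉ I}.indicator (fun k => ‖c k i‖ₑ ^ 2) k :=
          Summable.tsum_finsetSum fun _ _ => ENNReal.summable
      _ ≤ ∑ _i : ι, ENNReal.ofReal η := Finset.sum_le_sum fun i _ => htail i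
      _ = _ := by simp
  have hreal : d * A ≤ Fintype.card ι * η := by
    have := ENNReal.toReal_mono (by finiteness) hmain
    simpa [hA, hη] using this
  have hd' : (Fintype.card ι : ℝ) ≤ I.card + d := by exact_mod_cast hd
  nlinarith

theorem exists_lattice_finset (p : ℝ × ℝ) {r : ℝ} (hr : 1 ≤ r) :
    ∃ J : Finset (ℤ × ℤ), (∀ j, j ∈ J ↔ latticePoint j ∈ square p r) ∧
      (2 * r - 1) ^ 2 ≤ (J.card : ℝ) ∧ (J.card : ℝ) ≤ (2 * r + 1) ^ 2 := by
  have key : ∀ a : ℝ, 2 * r - 1 ≤ ((Finset.Icc ⌈a - r⌉ ⌊a + r⌋).card : ℝ) ∧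
      ((Finset.Icc ⌈a - r⌉ ⌊a + r⌋).card : ℝ) ≤ 2 * r + 1 := by
    intro a
    have h1 := Int.floor_le (a + r)
    have h2 := Int.lt_floor_add_one (a + r)
    have h3 := Int.le_ceil (a - r)
    have h4 := Int.ceil_lt_add_one (a - r)
    have h5 : 0 ≤ ⌊a + r⌋ + 1 - ⌈a - r⌉ := by
      have : (0 : ℝ) < (⌊a + r⌋ + 1 - ⌈a - r⌉ : ℤ) := by push_cast; linarith
      exact_mod_cast this.le
    have h6 : ((Finset.Icc ⌈a - r⌉ ⌊a + r⌋).card : ℝ) = ⌊a + r⌋ + 1 - ⌈a - r⌉ := by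
      rw [Int.card_Icc]
      exact_mod_cast Int.toNat_of_nonneg h5
    rw [h6]
    constructor <;> linarith
  refine ⟨Finset.Icc ⌈p.1 - r⌉ ⌊p.1 + r⌋ ×ˢ Finset.Icc ⌈p.2 - r⌉ ⌊p.2 + r⌋, fun j => ?_, ?_, ?_⟩
  · simp only [Finset.mem_product, Finset.mem_Icc, Int.ceil_le, Int.le_floor, mem_square,
      latticePoint, abs_le]
    constructor
    · rintro ⟨⟨h1, h2⟩, h3, h4⟩
      refine ⟨⟨?_, ?_⟩, ?_, ?_⟩ <;> linarith
    · rintro ⟨⟨h1, h2⟩, h3, h4⟩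
      refine ⟨⟨?_, ?_⟩, ?_, ?_⟩ <;> linarith
  · rw [Finset.card_product, Nat.cast_mul, sq]
    exact mul_le_mul (key _).1 (key _).1 (by linarith) (Nat.cast_nonneg _)
  · rw [Finset.card_product, Nat.cast_mul, sq]
    exact mul_le_mul (key _).2 (key _).2 (Nat.cast_nonneg _) (by linarith)

theorem exists_family_finset {N : ℕ} {Λ : Fin N → Set (ℝ × ℝ)}
    (hΛ : ∀ n, UniformlyDiscrete (Λ n)) (p : ℝ × ℝ) (r : ℝ) :
    ∃ I : Finset (Σ n : Fin N, Λ n), (∀ i, i ∈ I ↔ (i.2 : ℝ × ℝ) ∈ square p r) ∧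
      I.card = familyCount Λ p r := by
  have hfin : ∀ n, ((↑) ⁻¹' square p r : Set (Λ n)).Finite := fun n => by
    refine Set.Finite.of_finite_image (f := ((↑) : Λ n → ℝ × ℝ)) ?_
      Subtype.val_injective.injOn
    rw [Subtype.image_preimage_coe]
    exact (hΛ n).finite_inter_square p r
  refine ⟨Finset.univ.sigma fun n => (hfin n).toFinset, fun i => by simp, ?_⟩
  rw [Finset.card_sigma, familyCount]
  refine Finset.sum_congr rfl fun n _ => ?_
  rw [← Set.ncard_eq_toFinset_card _ (hfin n), ← Subtype.image_preimage_coe,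
    Set.ncard_image_of_injective _ Subtype.val_injective]

theorem square_subset_square {p q : ℝ × ℝ} {r R : ℝ} (h : q ∈ square p r) :
    square q R ⊆ square p (r + R) := by
  rintro x ⟨h1, h2⟩
  obtain ⟨h3, h4⟩ := h
  rw [abs_le] at h1 h2 h3 h4
  rw [mem_square, abs_le, abs_le]
  refine ⟨⟨?_, ?_⟩, ?_, ?_⟩ <;> linarith

theorem norm_sum_smul_sq {H ι : Type*} [NormedAddCommGroup H] [InnerProductSpace ℂ H]
    [Fintype ι] {e : ι → H} (he : Orthonormal ℂ e) (a : EuclideanSpace ℂ ι) :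
    ‖∑ i, a i • e i‖ ^ 2 = ‖a‖ ^ 2 := by
  have h := he.inner_sum a a Finset.univ
  rw [inner_self_eq_norm_sq_to_K] at h
  have h2 : (inner ℂ a a : ℂ) = ∑ i, (starRingEnd ℂ) (a i) * a i := by
    rw [PiLp.inner_apply]
    exact Finset.sum_congr rfl fun i _ => by rw [RCLike.inner_apply, mul_comm]
  rw [← h2, inner_self_eq_norm_sq_to_K] at h
  exact_mod_cast h

/-- The inverse of `T` is bounded and carries the combination to one of orthonormal vectors. The `+
1` in `C` keeps it positive if the span is trivial. -/
theorem IsRieszSequence.exists_lower_bound {H κ : Type*} [NormedAddCommGroup H]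
    [InnerProductSpace ℂ H] {v : κ → H} (hv : IsRieszSequence v) :
    ∃ c : ℝ, 0 < c ∧ ∀ (I : Finset κ) (a : EuclideanSpace ℂ I),
      c * ‖a‖ ^ 2 ≤ ‖∑ i, a i • v i‖ ^ 2 := by
  obtain ⟨e, T, hT⟩ := hv
  set C := ‖(T.symm : closedSpan v →L[ℂ] closedSpan v)‖ + 1
  have hC : 0 < C := by positivity
  refine ⟨(C ^ 2)⁻¹, by positivity, fun I a => ?_⟩
  have he : Orthonormal ℂ fun i : I => e i := e.orthonormal.comp _ Subtype.val_injective
  set x := ∑ i, a i • e (i : κ)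
  have h1 : ((T x : closedSpan v) : H) = ∑ i, a i • v i := by
    simp only [x, map_sum, map_smul, ← hT, Submodule.coe_sum, Submodule.coe_smul]
  have h2 : ‖x‖ ≤ C * ‖T x‖ := by
    calc ‖x‖ = ‖(T.symm : closedSpan v →L[ℂ] closedSpan v) (T x)‖ := by simp
      _ ≤ ‖(T.symm : closedSpan v →L[ℂ] closedSpan v)‖ * ‖T x‖ :=
          ContinuousLinearMap.le_opNorm _ _
      _ ≤ _ := by gcongr; simp [C]
  rw [← norm_sum_smul_sq he a, ← h1, inv_mul_le_iff₀ (by positivity), ← mul_pow]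
  exact pow_le_pow_left₀ (norm_nonneg _) h2 2

theorem latticePoint_separated (j k : ℤ × ℤ) (h : j ≠ k) :
    (1 / 2 : ℝ) < √(((latticePoint j).1 - (latticePoint k).1) ^ 2
      + ((latticePoint j).2 - (latticePoint k).2) ^ 2) := by
  have key : ∀ a b : ℤ, a ≠ b → (1 : ℝ) ≤ ((a : ℝ) - b) ^ 2 := by
    intro a b hab
    have h1 : 0 < (a - b) ^ 2 := by
      have : a - b ≠ 0 := sub_ne_zero.2 hab
      positivity
    exact_mod_cast (show (1 : ℤ) ≤ (a - b) ^ 2 by omega)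
  rw [Real.lt_sqrt (by norm_num)]
  simp only [latticePoint]
  by_cases h1 : j.1 = k.1
  · have h2 : j.2 ≠ k.2 := fun h2 => h (Prod.ext h1 h2)
    nlinarith [key _ _ h2, sq_nonneg ((j.1 : ℝ) - k.1)]
  · nlinarith [key _ _ h1, sq_nonneg ((j.2 : ℝ) - k.2)]

end Comparison

/-! ### Comparison with the reference basis and passage to the limit -/

section Main

variable {N : ℕ} {Λ : Fin N → Set (ℝ × ℝ)}

theorem enorm_sq_eq_ofReal {E : Type*} [NormedAddCommGroup E] (x : E) :
    ‖x‖ₑ ^ 2 = ENNReal.ofReal (‖x‖ ^ 2) := by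
  rw [ENNReal.ofReal_pow (norm_nonneg _), ofReal_norm]

theorem exists_forall_tail_unitBasis_le (g : Fin N → L2R) {η : ℝ} (hη : 0 < η) :
    ∃ R : ℝ, 0 < R ∧ ∀ n p, ∑' j, {j | latticePoint j ∉ square p R}.indicator
      (fun j => ‖(inner ℂ (unitBasis j) (gaborShift (g n) p) : ℂ)‖ₑ ^ 2) j
        ≤ ENNReal.ofReal η := by
  have h : ∀ n, ∃ R : ℝ, 0 < R ∧ ∀ p, ∑' j, {j | latticePoint j ∉ square p R}.indicator
      (fun j => ‖(inner ℂ (unitBasis j) (gaborShift (g n) p) : ℂ)‖ₑ ^ 2) j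
        ≤ ENNReal.ofReal η := fun n =>
    exists_tail_le one_half_pos latticePoint_separated ENNReal.one_ne_top
      (fun y => by rw [one_mul]; exact (tsum_enorm_inner_unitBasis y).le)
      (ne_top_of_le_ne_top (by finiteness) (lintegral_inner_unitWindow_le (g n)))
      (by simpa using hη)
  choose R hR0 hR using h
  -- A radius that dominates every `R n`; the `1` keeps it positive for `N = 0`.
  refine ⟨1 + ∑ n, R n, add_pos_of_pos_of_nonneg one_pos
    (Finset.sum_nonneg fun n _ => (hR0 n).le), fun n p => le_trans ?_ (hR n p)⟩
  refine ENNReal.tsum_le_tsum fun j => Set.indicator_le_indicator_of_subset ?_ (by simp) _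
  intro j hj hj'
  have h1 : R n ≤ 1 + ∑ n, R n := by
    linarith [Finset.single_le_sum (f := R) (fun n _ => (hR0 n).le) (Finset.mem_univ n)]
  exact hj ⟨hj'.1.trans h1, hj'.2.trans h1⟩

theorem exists_forall_tail_gaborUnion_le (hΛ : ∀ n, UniformlyDiscrete (Λ n)) (g : Fin N → L2R)
    {B : ENNReal} (hB : B ≠ ⊤)
    (hbessel : ∀ y : L2R, ∑' i, ‖(inner ℂ (gaborUnion g Λ i) y : ℂ)‖ₑ ^ 2 ≤ B * ‖y‖ₑ ^ 2)
    {η : ℝ} (hη : 0 < η) :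
    ∃ R : ℝ, 0 < R ∧ ∀ p, ∑' i : Σ n : Fin N, Λ n,
      {i : Σ n : Fin N, Λ n | (i.2 : ℝ × ℝ) ∉ square p R}.indicator
        (fun i => ‖(inner ℂ (gaborUnion g Λ i) (gaborShift unitWindow p) : ℂ)‖ₑ ^ 2) i
        ≤ ENNReal.ofReal η := by
  have h : ∀ n, ∃ R : ℝ, 0 < R ∧ ∀ p, ∑' k : Λ n, {k : Λ n | (k : ℝ × ℝ) ∉ square p R}.indicator
      (fun k => ‖(inner ℂ (gaborShift (g n) k) (gaborShift unitWindow p) : ℂ)‖ₑ ^ 2) k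
        ≤ ENNReal.ofReal (η / (N + 1)) := by
    intro n
    have : Countable (Λ n) := (hΛ n).countable.to_subtype
    obtain ⟨δ, hδ, hsep⟩ := hΛ n
    refine exists_tail_le (x := fun k : Λ n => (k : ℝ × ℝ)) hδ
      (fun k l hkl => hsep k k.2 l l.2 (Subtype.coe_ne_coe.2 hkl)) hB
      (fun y => le_trans ?_ (hbessel y))
      (ne_top_of_le_ne_top (by finiteness) (lintegral_inner_gaborShift_unitWindow_le (g n)))
      (ENNReal.ofReal_pos.2 (by positivity)).ne'
    exact ENNReal.tsum_comp_le_tsum_of_injective (sigma_mk_injective (i := n))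
      (fun i => ‖(inner ℂ (gaborUnion g Λ i) y : ℂ)‖ₑ ^ 2)
  choose R hR0 hR using h
  refine ⟨1 + ∑ n, R n, add_pos_of_pos_of_nonneg one_pos
    (Finset.sum_nonneg fun n _ => (hR0 n).le), fun p => ?_⟩
  rw [ENNReal.tsum_sigma', tsum_fintype]
  calc _ ≤ ∑ _n : Fin N, ENNReal.ofReal (η / (N + 1)) := by
        refine Finset.sum_le_sum fun n _ => le_trans (ENNReal.tsum_le_tsum fun k => ?_) (hR n p)
        by_cases hk : (k : ℝ × ℝ) ∈ square p (R n)
        · have h1 : R n ≤ 1 + ∑ n, R n := by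
            linarith [Finset.single_le_sum (f := R) (fun n _ => (hR0 n).le) (Finset.mem_univ n)]
          have h2 : (k : ℝ × ℝ) ∈ square p (1 + ∑ n, R n) := ⟨hk.1.trans h1, hk.2.trans h1⟩
          rw [Set.indicator_of_notMem (by simpa using h2)]
          exact zero_le
        · rw [Set.indicator_of_mem (a := k) (by exact hk)]
          exact Set.indicator_le_self _ _ _
    _ = ENNReal.ofReal (N * (η / (N + 1))) := by
        rw [ENNReal.ofReal_mul (Nat.cast_nonneg _)]
        simp
    _ ≤ ENNReal.ofReal η := by
        refine ENNReal.ofReal_le_ofReal ?_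
        rw [← mul_div_assoc, div_le_iff₀ (by positivity)]
        nlinarith

/-- Comparison of a Riesz sequence with the basis `unitBasis`. -/
theorem IsRieszSequence.familyCount_le (hΛ : ∀ n, UniformlyDiscrete (Λ n)) {g : Fin N → L2R}
    (h : IsRieszSequence (gaborUnion g Λ)) :
    ∃ c : ℝ, 0 < c ∧ ∀ η : ℝ, 0 < η → ∃ R : ℝ, 0 < R ∧ ∀ p r, 1 ≤ r →
      (c - η) * familyCount Λ p r ≤ c * (2 * (r + R) + 1) ^ 2 := by
  classical
  obtain ⟨c, hc, hlow⟩ := h.exists_lower_bound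
  refine ⟨c, hc, fun η hη => ?_⟩
  obtain ⟨R, hR, htail⟩ := exists_forall_tail_unitBasis_le g hη
  refine ⟨R, hR, fun p r hr => ?_⟩
  obtain ⟨I, hI, hIcard⟩ := exists_family_finset hΛ p r
  obtain ⟨J, hJ, -, hJcard⟩ := exists_lattice_finset p (r := r + R) (by linarith)
  -- Columns are the atoms in `square p r`, rows the lattice points. The lower bound is the Riesz
  -- bound rewritten by Parseval.
  have key := mul_card_sub_card_le (ι := I)
    (fun j i => (inner ℂ (unitBasis j) (gaborUnion g Λ i) : ℂ)) hc.le hη.le ?_ J ?_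
  · rw [Fintype.card_coe, hIcard] at key
    nlinarith
  · intro a
    refine (ENNReal.ofReal_le_ofReal (hlow I a)).trans ?_
    rw [← enorm_sq_eq_ofReal, ← tsum_enorm_inner_unitBasis]
    refine ENNReal.tsum_le_tsum fun j => ?_
    simp [inner_sum, inner_smul_right]
  · intro i
    refine le_trans (ENNReal.tsum_le_tsum fun j => ?_)
      (htail (i : Σ n : Fin N, Λ n).1 (i : Σ n : Fin N, Λ n).2)
    refine Set.indicator_le_indicator_of_subset ?_ (by simp) _
    intro j hj hj'
    exact hj ((hJ j).2 (square_subset_square ((hI i).1 i.2) hj'))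

/-- Comparison of a frame with the basis `unitBasis`. -/
theorem IsFrame.le_familyCount (hΛ : ∀ n, UniformlyDiscrete (Λ n)) {g : Fin N → L2R}
    (h : IsFrame (gaborUnion g Λ)) :
    ∃ A : ℝ, 0 < A ∧ ∀ η : ℝ, 0 < η → η ≤ A → ∃ R : ℝ, 0 < R ∧ ∀ p r, 1 ≤ r →
      (A - η) * (2 * r - 1) ^ 2 ≤ A * familyCount Λ p (r + R) := by
  classical
  obtain ⟨A, B, hA, hB, hframe⟩ := h
  have hsum : ∀ y : L2R, ∑' i, ‖(inner ℂ (gaborUnion g Λ i) y : ℂ)‖ₑ ^ 2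
      = ENNReal.ofReal (∑' i, ‖(inner ℂ (gaborUnion g Λ i) y : ℂ)‖ ^ 2) := by
    intro y
    rw [ENNReal.ofReal_tsum_of_nonneg (fun _ => by positivity) (hframe y).1]
    exact tsum_congr fun i => enorm_sq_eq_ofReal _
  refine ⟨A, hA, fun η hη hηA => ?_⟩
  obtain ⟨R, hR, htail⟩ := exists_forall_tail_gaborUnion_le hΛ g (B := ENNReal.ofReal B) (by simp)
    (fun y => by
      rw [hsum, enorm_sq_eq_ofReal, ← ENNReal.ofReal_mul hB.le]
      exact ENNReal.ofReal_le_ofReal (hframe y).2.2) hη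
  refine ⟨R, hR, fun p r hr => ?_⟩
  obtain ⟨I, hI, hIcard⟩ := exists_family_finset hΛ p (r + R)
  obtain ⟨J, hJ, hJcard, -⟩ := exists_lattice_finset p hr
  -- The roles are reversed: columns are the lattice points in `square p r`, rows the atoms. The
  -- lower bound is the frame bound on combinations of orthonormal vectors.
  have key := mul_card_sub_card_le (ι := J)
    (fun i j => (inner ℂ (gaborUnion g Λ i) (unitBasis j) : ℂ)) hA.le hη.le ?_ I ?_
  · rw [Fintype.card_coe, hIcard] at key
    nlinarith [mul_le_mul_of_nonneg_left hJcard (sub_nonneg.2 hηA)]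
  · intro a
    rw [← norm_sum_smul_sq
      (orthonormal_unitBasis.comp ((↑) : J → ℤ × ℤ) Subtype.val_injective) a]
    refine (ENNReal.ofReal_le_ofReal (hframe _).2.1).trans ?_
    rw [← hsum]
    refine ENNReal.tsum_le_tsum fun j => ?_
    simp [inner_sum, inner_smul_right]
  · intro j
    refine le_trans (ENNReal.tsum_le_tsum fun i => ?_) (htail (latticePoint j))
    refine Set.indicator_le_indicator_of_subset ?_ (by simp) _
    intro i hi hi'
    exact hi ((hI i).2 (square_subset_square ((hJ j).1 j.2) hi'))

theorem tendsto_affine_sq_div (b : ℝ) :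
    Tendsto (fun r : ℝ => (2 * r + b) ^ 2 / (2 * r) ^ 2) atTop (𝓝 1) := by
  have h : Tendsto (fun r : ℝ => (1 + b / 2 * r⁻¹) ^ 2) atTop (𝓝 1) := by
    have := ((tendsto_inv_atTop_zero.const_mul (b / 2)).const_add (1 : ℝ)).pow 2
    simpa using this
  refine h.congr' ?_
  filter_upwards [eventually_gt_atTop 0] with r hr
  field_simp

theorem HasUpperDensity.le_one {D : ℝ} (hD : HasUpperDensity Λ D)
    (hΛ : ∀ n, UniformlyDiscrete (Λ n)) {g : Fin N → L2R}
    (h : IsRieszSequence (gaborUnion g Λ)) : D ≤ 1 := by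
  obtain ⟨c, hc, hcount⟩ := h.familyCount_le hΛ
  have key : ∀ η : ℝ, 0 < η → (c - η) * D ≤ c := by
    intro η hη
    obtain ⟨R, hR, hle⟩ := hcount η hη
    have hlim := (tendsto_affine_sq_div (2 * R + 1)).const_mul c
    rw [mul_one] at hlim
    refine le_of_tendsto_of_tendsto (hD.const_mul (c - η)) hlim ?_
    filter_upwards [eventually_ge_atTop 1] with r hr
    obtain ⟨p, hp⟩ : (⨆ p, familyCount Λ p r) ∈ Set.range fun p => familyCount Λ p r :=
      Nat.sSup_mem (Set.range_nonempty _) (bddAbove_familyCount hΛ r)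
    rw [← hp, ← mul_div_assoc, ← mul_div_assoc]
    refine div_le_div_of_nonneg_right ((hle p r hr).trans (le_of_eq ?_)) (by positivity)
    ring
  by_contra! hD1
  -- With this `η` the left side is `c * (D + 1) / 2`, which exceeds `c` when `D > 1`.
  have := key (c * (D - 1) / (2 * D)) (by
    have : 0 < D - 1 := by linarith
    positivity)
  have h2 : (c - c * (D - 1) / (2 * D)) * D = c * D - c * (D - 1) / 2 := by
    field_simp
  nlinarith

theorem HasLowerDensity.one_le {D : ℝ} (hD : HasLowerDensity Λ D)
    (hΛ : ∀ n, UniformlyDiscrete (Λ n)) {g : Fin N → L2R}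
    (h : IsFrame (gaborUnion g Λ)) : 1 ≤ D := by
  obtain ⟨A, hA, hcount⟩ := h.le_familyCount hΛ
  have key : ∀ η : ℝ, 0 < η → η ≤ A → A - η ≤ A * D := by
    intro η hη hηA
    obtain ⟨R, hR, hle⟩ := hcount η hη hηA
    have hlim := (tendsto_affine_sq_div (-(2 * R + 1))).const_mul (A - η)
    rw [mul_one] at hlim
    refine le_of_tendsto_of_tendsto hlim (hD.const_mul A) ?_
    filter_upwards [eventually_ge_atTop (1 + R)] with r hr
    obtain ⟨p, hp⟩ : (⨅ p, familyCount Λ p r) ∈ Set.range fun p => familyCount Λ p r :=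
      Nat.sInf_mem (Set.range_nonempty _)
    rw [← hp, ← mul_div_assoc, ← mul_div_assoc]
    have h1 := hle p (r - R) (by linarith)
    rw [sub_add_cancel] at h1
    refine div_le_div_of_nonneg_right (le_trans (le_of_eq ?_) h1) (by positivity)
    ring
  by_contra! hD1
  have h1 : 0 < A * (1 - D) / 2 := by
    have : 0 < 1 - D := by linarith
    positivity
  -- The second entry gives `A * (1 - D) ≤ A * (1 - D) / 2`, impossible for `D < 1`; the first
  -- ensures `η ≤ A`.
  have h2 := key (min A (A * (1 - D) / 2)) (by positivity) (min_le_left _ _)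
  have h3 := min_le_right A (A * (1 - D) / 2)
  linarith

end Main

/-- Both densities of a uniformly discrete family exist (as limits). The upper one is at most `1`
if the union of the Gabor systems is a Riesz sequence, and the lower one is at least `1` if the
union is a frame. -/
theorem theoremA (N : ℕ) (g : Fin N → L2R) (hg : Function.Injective g)
    (Λ : Fin N → Set (ℝ × ℝ)) (hΛ : ∀ n, UniformlyDiscrete (Λ n)) :
    ∃ Dplus Dminus : ℝ, HasUpperDensity Λ Dplus ∧ HasLowerDensity Λ Dminus ∧
      (IsRieszSequence (gaborUnion g Λ) → Dplus ≤ 1) ∧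
      (IsFrame (gaborUnion g Λ) → 1 ≤ Dminus) := by
  obtain ⟨Dplus, hplus⟩ := exists_hasUpperDensity hΛ
  obtain ⟨Dminus, hminus⟩ := exists_hasLowerDensity hΛ
  exact ⟨Dplus, Dminus, hplus, hminus, fun h => hplus.le_one hΛ h, fun h => hminus.one_le hΛ h⟩

end
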